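/- **Notation.** Let $d\ge 1$ be an integer, $0<p,\theta\le\infty$, $\alpha>1/p$ (with $1/\infty=0$), and let $\ell$ be an integer with $\ell>\alpha$. Write $\mathbb I=[0,1]$, $a_+=\max\{a,0\}$, and let $\|\cdot\|_p$ be the (quasi-)norm of $L_p([0,1]^d)$. Functions are complex valued; functions on the torus $\mathbb T^d$ are functions on $\mathbb R^d$ that are $1$-periodic in each variable. For $e\subset\{1,\dots,d\}$ and $h\in\mathbb R^d$ let $\Delta_h^{\ell,e}=\prod_{i\in e}\Delta_{h_i}^{\ell}$, where $\Delta^\ell_{h_i}$ is the difference operator $g\mapsto\sum_{j=0}^{\ell}(-1)^{\ell-j}\binom{\ell}{j}g(\cdot+jh_i)$ applied in the variable $x_i$, and $\Delta_h^{\ell,\emptyset}=\mathrm{Id}$. For functions on the cube $\mathbb I^d$, $\Delta_h^{\ell,e}f(x)$ is set to $0$ unless $x_i+\ell h_i\in[0,1]$ for all $i\in e$; for functions on $\mathbb T^d$ there is no such truncation. For $t\in(0,1]^d$ put $$\omega_\ell^e(f,t)_p=\sup_{|h_i|<t_i,\ i\in e}\|\Delta_h^{\ell,e}f\|_p ,$$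 $$|f|_{B^{\alpha,e}_{p,\theta}}=\Big(\int_{(0,1]^d}\Big[\prod_{i\in e}t_i^{-\alpha}\,\omega^e_\ell(f,t)_p\Big]^{\theta}\prod_{i\in e}t_i^{-1}\,dt\Big)^{1/\theta}\quad(\theta<\infty),$$ $$|f|_{B^{\alpha,e}_{p,\infty}}=\sup_{t\in(0,1]^d}\prod_{i\in e}t_i^{-\alpha}\,\omega^e_\ell(f,t)_p ,$$ and $\|f\|_{B^\alpha_{p,\theta}}=\sum_{e\subset\{1,\dots,d\}}|f|_{B^{\alpha,e}_{p,\theta}}$. Let $U^\alpha_{p,\theta}(\mathbb T^d)$ and $U^\alpha_{p,\theta}(\mathbb I^d)$ be the sets of continuous functions $f$ on $\mathbb T^d$, respectively on $\mathbb I^d$, with $\|f\|_{B^\alpha_{p,\theta}(\mathbb T^d)}\le1$ (untruncated differences), respectively $\|f\|_{B^\alpha_{p,\theta}(\mathbb I^d)}\le 1$ (truncated differences). For a class $F$ of functions that are defined on $[0,1]^d$ let $$\mathrm{Int}_n(F)=\inf_{x^1,\dots,x^n\in[0,1]^d,\ \lambda_1,\dots,\lambda_n\in\mathbb R}\ \sup_{f\in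 F}\Big|\int_{[0,1]^d}f(x)\,dx-\sum_{j=1}^n\lambda_jf(x^j)\Big| .$$ **Theorem.** There is a constant $c>0$ that depends only on $d,p,\theta,\alpha,\ell$ such that for all integers $n\ge1$ $$\mathrm{Int}_n(F)\ \ge\ c\,n^{-\alpha}(\log n)^{(d-1)(1-1/\theta)_+}$$ for each of the three classes $F=U^\alpha_{p,\theta}(\mathbb T^d)$, $F=U^\alpha_{p,\theta}(\mathbb I^d)$, and $F=\{f\in U^\alpha_{p,\theta}(\mathbb I^d): f \text{ is the restriction of a continuous function on }\mathbb T^d\}$ (with $0^0=1$ if $n=1$ and the exponent of the logarithm is $0$). -/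

import Mathlib

open MeasureTheory
open scoped ENNReal

noncomputable section

/-- The closed unit cube `[0,1]^d`. -/
def unitCube (d : ℕ) : Set (Fin d → ℝ) := Set.univ.pi fun _ => Set.Icc (0 : ℝ) 1

/-- The mixed `(ℓ,e)`-th difference `∏_{i ∈ e} Δ_{h_i}^ℓ` of a function on `ℝ^d`, where `Δ_{h_i}^ℓ`
acts on the variable `x_i`. The product of the univariate operators is written out: the sum is over
all `j` with `j_i ∈ {0, …, ℓ}` for `i ∈ e` and `j_i = 0` for `i ∉ e`. -/
def mixedDifference {d : ℕ} (ℓ : ℕ) (e : Finset (Fin d)) (h : Fin d → ℝ)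
    (f : (Fin d → ℝ) → ℂ) (x : Fin d → ℝ) : ℂ :=
  ∑ j ∈ Fintype.piFinset fun i => if i ∈ e then Finset.range (ℓ + 1) else {0},
    (∏ i ∈ e, (-1 : ℂ) ^ (ℓ - j i) * (ℓ.choose (j i) : ℂ)) * f fun i => x i + (j i : ℝ) * h i

open Classical in
/-- The mixed `(ℓ,e)`-th difference of a function on the cube `[0,1]^d`: it is set to zero unless
`x_i + ℓ h_i ∈ [0,1]` for all `i ∈ e`. For `x ∈ [0,1]^d` only values of `f` on `[0,1]^d` are used. -/
def cubeDifference {d : ℕ} (ℓ : ℕ) (e : Finset (Fin d)) (h : Fin d → ℝ)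
    (f : (Fin d → ℝ) → ℂ) (x : Fin d → ℝ) : ℂ :=
  if ∀ i ∈ e, x i + (ℓ : ℝ) * h i ∈ Set.Icc (0 : ℝ) 1 then mixedDifference ℓ e h f x else 0

/-- The mixed modulus of smoothness `ω^e(t)_p = sup_{|h_i| < t_i, i ∈ e} ‖D e h‖_{L_p([0,1]^d)}`,
where `D e h` stands for the difference with steps `h` in the directions `e` of a fixed function. -/
def mixedModulus {d : ℕ} (D : Finset (Fin d) → (Fin d → ℝ) → (Fin d → ℝ) → ℂ) (p : ℝ≥0∞)
    (e : Finset (Fin d)) (t : Fin d → ℝ) : ℝ≥0∞ :=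
  ⨆ (h : Fin d → ℝ) (_ : ∀ i ∈ e, |h i| < t i), eLpNorm (D e h) p (volume.restrict (unitCube d))

/-- The Besov quasi-seminorm of mixed smoothness `α` in the directions `e`, with values in `[0,∞]`.
The parameter `t` runs through `(0,1]^d`. -/
def besovSeminorm {d : ℕ} (D : Finset (Fin d) → (Fin d → ℝ) → (Fin d → ℝ) → ℂ) (α : ℝ)
    (p θ : ℝ≥0∞) (e : Finset (Fin d)) : ℝ≥0∞ :=
  if θ = ∞ then
    ⨆ t ∈ Set.univ.pi fun _ : Fin d => Set.Ioc (0 : ℝ) 1,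
      (∏ i ∈ e, ENNReal.ofReal (t i) ^ (-α)) * mixedModulus D p e t
  else
    (∫⁻ t in Set.univ.pi fun _ : Fin d => Set.Ioc (0 : ℝ) 1,
      ((∏ i ∈ e, ENNReal.ofReal (t i) ^ (-α)) * mixedModulus D p e t) ^ θ.toReal *
        ∏ i ∈ e, (ENNReal.ofReal (t i))⁻¹) ^ (1 / θ.toReal)

/-- The sum of the quasi-seminorms over all subsets `e` of the set of directions. -/
def besovNorm {d : ℕ} (D : Finset (Fin d) → (Fin d → ℝ) → (Fin d → ℝ) → ℂ) (α : ℝ)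
    (p θ : ℝ≥0∞) : ℝ≥0∞ :=
  ∑ e : Finset (Fin d), besovSeminorm D α p θ e

/-- The quasi-norm of `B^α_{p,θ}(𝕋^d)` by differences of order `ℓ`; a function on the torus is a
function on `ℝ^d` that is `1`-periodic in each variable, so its differences are not truncated. -/
def torusBesovNorm {d : ℕ} (ℓ : ℕ) (α : ℝ) (p θ : ℝ≥0∞) (f : (Fin d → ℝ) → ℂ) : ℝ≥0∞ :=
  besovNorm (fun e h => mixedDifference ℓ e h f) α p θ

/-- The quasi-norm of `B^α_{p,θ}([0,1]^d)` by differences of order `ℓ`. -/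
def cubeBesovNorm {d : ℕ} (ℓ : ℕ) (α : ℝ) (p θ : ℝ≥0∞) (f : (Fin d → ℝ) → ℂ) : ℝ≥0∞ :=
  besovNorm (fun e h => cubeDifference ℓ e h f) α p θ

/-- Continuous functions on the torus, as `1`-periodic functions on `ℝ^d`. -/
def IsTorusFunction {d : ℕ} (f : (Fin d → ℝ) → ℂ) : Prop :=
  Continuous f ∧ ∀ (i : Fin d) (x : Fin d → ℝ), f (x + Pi.single i 1) = f x

/-- The unit ball of `B^α_{p,θ}(𝕋^d)` (continuous representatives, so that function values make
sense). -/
def torusBall (d ℓ : ℕ) (α : ℝ) (p θ : ℝ≥0∞) : Set ((Fin d → ℝ) → ℂ) :=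
  {f | IsTorusFunction f ∧ torusBesovNorm ℓ α p θ f ≤ 1}

/-- The unit ball of `B^α_{p,θ}([0,1]^d)` (continuous representatives). -/
def cubeBall (d ℓ : ℕ) (α : ℝ) (p θ : ℝ≥0∞) : Set ((Fin d → ℝ) → ℂ) :=
  {f | ContinuousOn f (unitCube d) ∧ cubeBesovNorm ℓ α p θ f ≤ 1}

/-- The cubature formula with `n` knots `X` and real weights `w`. -/
def cubature {d n : ℕ} (X : Fin n → Fin d → ℝ) (w : Fin n → ℝ) (f : (Fin d → ℝ) → ℂ) : ℂ :=
  ∑ j, (w j : ℂ) * f (X j)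

/-- The optimal worst-case cubature error `Int_n(F)`, with values in `[0,∞]`: the infimum over all
choices of `n` knots in `[0,1]^d` and `n` real weights of the supremum over `f ∈ F` of the
absolute error. -/
def optimalCubatureError {d : ℕ} (n : ℕ) (F : Set ((Fin d → ℝ) → ℂ)) : ℝ≥0∞ :=
  ⨅ (X : Fin n → Fin d → ℝ) (_ : ∀ j, X j ∈ unitCube d) (w : Fin n → ℝ),
    ⨆ f ∈ F, ENNReal.ofReal ‖(∫ x in unitCube d, f x) - cubature X w f‖

end

/-! The lower bound comes from fooling functions (`exists_fooling_function`): members of the unit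
ball that vanish at all knots, so that the error is their integral whatever the weights are.

Choose `m` with `2 ^ m` between `2 n` and `4 n`. For every `k` with `∑ i, k i = m`, the grid with `2
^ k i` cells in direction `i` has `2 ^ m` cells, at least half of them free of knots
(`sub_le_sum_emptyCell`). Bumps on the free cells form a function whose integral is bounded below
independently of `k` and `m`. The fooling function is a multiple of the sum of these functions over
a set `K` of `N` such `k`; before scaling, its integral is at least of order `N`.

The cost is the Besov norm. Scale `k` contributes at most a constant times `∏ min 1 (2 ^ k i * |h
i|) ^ ℓ` to the mixed difference (`exists_norm_mixedDifference_cellFun_le`). Since `0 < α < ℓ`, the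
weighted modulus at `t` is `2 ^ (α m)` times a sum of terms decaying geometrically as `t i` moves
away from `2 ^ (-k i)`. So different scales are active at essentially different `t`, their `θ`-th
powers add up, and the norm is of order at most `2 ^ (α m) * N ^ (1/θ)` (`besovNorm_le`). The
quotient is `2 ^ (-α m) * N ^ (1 - 1/θ)`. For `θ ≥ 1` take `N` of order `m ^ (d-1)`, for `θ < 1`
take `N = 1`. -/

/-! ### Decay estimates across dyadic scales. -/

/-- Telescoping bound for a geometric progression of arguments. -/
lemma min_le_mul_sub_div {b X : ℝ} (hb : 1 < b) (hX : 0 < X) :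
    min X X⁻¹ ≤ 4 * b / (b - 1) * (b * X / (1 + b * X) - X / (1 + X)) := by
  have hb' : 0 < b - 1 := by linarith
  have h1 : 4 * b / (b - 1) * (b * X / (1 + b * X) - X / (1 + X))
      = 4 * b * X / ((1 + b * X) * (1 + X)) := by
    have : 1 + b * X ≠ 0 := by positivity
    have : 1 + X ≠ 0 := by positivity
    field_simp
    ring
  rw [h1, le_div_iff₀ (by positivity)]
  rcases le_total X 1 with h | h
  · calc min X X⁻¹ * ((1 + b * X) * (1 + X)) ≤ X * ((1 + b * X) * (1 + X)) := by
          gcongr; exact min_le_left _ _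
      _ ≤ X * ((b + b * 1) * (1 + 1)) := by gcongr
      _ = _ := by ring
  · calc min X X⁻¹ * ((1 + b * X) * (1 + X)) ≤ X⁻¹ * ((1 + b * X) * (1 + X)) := by
          gcongr; exact min_le_right _ _
      _ ≤ X⁻¹ * ((b * X + b * X) * (X + X)) := by
          gcongr
          nlinarith
      _ = _ := by field_simp; ring

/-- The majorant of `s ^ (-α) * min 1 s ^ ℓ` used for the scale-wise estimates. -/
noncomputable def scaleDecay (β s : ℝ) : ℝ := Real.exp (-(β * |Real.log s|))

lemma scaleDecay_pos (β s : ℝ) : 0 < scaleDecay β s := Real.exp_pos _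

lemma scaleDecay_le_one {β : ℝ} (hβ : 0 ≤ β) (s : ℝ) : scaleDecay β s ≤ 1 := by
  unfold scaleDecay
  rw [Real.exp_le_one_iff]
  have := abs_nonneg (Real.log s)
  nlinarith

lemma scaleDecay_rpow (β s θ : ℝ) : scaleDecay β s ^ θ = scaleDecay (β * θ) s := by
  unfold scaleDecay
  rw [← Real.exp_mul]
  ring_nf

lemma scaleDecay_anti {β γ : ℝ} (h : β ≤ γ) (s : ℝ) : scaleDecay γ s ≤ scaleDecay β s := by
  unfold scaleDecay
  have := abs_nonneg (Real.log s)
  gcongr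

@[fun_prop]
lemma measurable_scaleDecay (β : ℝ) : Measurable (scaleDecay β) := by
  unfold scaleDecay
  have : Measurable fun s : ℝ => |Real.log s| := Real.measurable_log.abs
  fun_prop

lemma scaleDecay_le_min {β s : ℝ} (hβ : 0 ≤ β) (hs : 0 < s) :
    scaleDecay β s ≤ min (s ^ β) (s ^ β)⁻¹ := by
  unfold scaleDecay
  rw [Real.rpow_def_of_pos hs, ← Real.exp_neg]
  have h1 := le_abs_self (Real.log s)
  have h2 := neg_abs_le (Real.log s)
  refine le_min (Real.exp_le_exp.2 ?_) (Real.exp_le_exp.2 ?_) <;> nlinarith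

/-- The left side is `s ^ (ℓ - α)` below `1` and `s ^ (-α)` above, so for `0 < α < ℓ` it decays on
both sides of `s = 1`; the smaller of the two exponents serves for both. -/
lemma rpow_mul_min_pow_le_scaleDecay {α s : ℝ} {ℓ : ℕ} (hs : 0 < s) :
    s ^ (-α) * min 1 s ^ ℓ ≤ scaleDecay (min α (ℓ - α)) s := by
  unfold scaleDecay
  rcases le_total s 1 with h | h
  · rw [min_eq_right h, ← Real.rpow_natCast, ← Real.rpow_add hs, Real.rpow_def_of_pos hs,
      abs_of_nonpos (Real.log_nonpos hs.le h)]
    have := Real.log_nonpos hs.le h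
    have h2 := min_le_right α (ℓ - α)
    apply Real.exp_le_exp.2
    nlinarith
  · rw [min_eq_left h, one_pow, mul_one, Real.rpow_def_of_pos hs,
      abs_of_nonneg (Real.log_nonneg h)]
    have := Real.log_nonneg h
    have h2 := min_le_left α (ℓ - α)
    apply Real.exp_le_exp.2
    nlinarith

/-- With `X = (2 ^ k * t) ^ β`, passing to `k + 1` multiplies `X` by `2 ^ β`. The terms are thus
dominated by increments of the bounded function `X / (1 + X)`, uniformly in `t` and `n`. -/
lemma sum_scaleDecay_le {β t : ℝ} (hβ : 0 < β) (ht : 0 < t) (n : ℕ) :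
    ∑ k ∈ Finset.range n, scaleDecay β (2 ^ k * t) ≤ 4 * 2 ^ β / (2 ^ β - 1) := by
  have hb : (1 : ℝ) < 2 ^ β := Real.one_lt_rpow (by norm_num) hβ
  have hb' : (0 : ℝ) < 2 ^ β - 1 := by linarith
  set F : ℕ → ℝ := fun k => (2 ^ k * t) ^ β / (1 + (2 ^ k * t) ^ β) with hF
  have hpos : ∀ k : ℕ, 0 < ((2 : ℝ) ^ k * t) ^ β := fun k => by positivity
  have hstep : ∀ k ∈ Finset.range n, scaleDecay β (2 ^ k * t)
      ≤ 4 * 2 ^ β / (2 ^ β - 1) * (F (k + 1) - F k) := by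
    intro k _
    have h1 : ((2 : ℝ) ^ (k + 1) * t) ^ β = 2 ^ β * (2 ^ k * t) ^ β := by
      rw [← Real.mul_rpow (by norm_num) (by positivity)]
      ring_nf
    simp only [hF, h1]
    exact (scaleDecay_le_min hβ.le (by positivity)).trans (min_le_mul_sub_div hb (hpos k))
  refine (Finset.sum_le_sum hstep).trans ?_
  rw [← Finset.mul_sum, Finset.sum_range_sub]
  have h1 : F n ≤ 1 := by
    have := hpos n
    simp only [hF]
    rw [div_le_one (by positivity)]
    linarith
  have h0 : 0 ≤ F 0 := by
    have := hpos 0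
    simp only [hF]
    positivity
  calc 4 * (2 : ℝ) ^ β / (2 ^ β - 1) * (F n - F 0) ≤ 4 * 2 ^ β / (2 ^ β - 1) * 1 := by
        gcongr
        linarith
    _ = _ := mul_one _

/-- The scale-invariant integral of `scaleDecay` is bounded uniformly in the scale. -/
lemma integrableOn_scaleDecay_div {β a : ℝ} (hβ : 0 < β) (ha : 0 < a) :
    IntegrableOn (fun t => scaleDecay β (a * t) * t⁻¹) (Set.Ioc 0 1) ∧
      ∫ t in Set.Ioc (0 : ℝ) 1, scaleDecay β (a * t) * t⁻¹ ≤ 4 / β := by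
  -- Continuous analogue of the telescoping: `F` is a bounded antiderivative of `F'`, which
  -- dominates the integrand because `min X X⁻¹ ≤ 4 * X / (1 + X) ^ 2`.
  set F : ℝ → ℝ := fun t => 4 / β * ((a * t) ^ β / (1 + (a * t) ^ β)) with hF
  set F' : ℝ → ℝ := fun t => 4 * ((a * t) ^ β / (1 + (a * t) ^ β) ^ 2) * t⁻¹ with hF'
  have hder : ∀ t ∈ Set.Ioo (0 : ℝ) 1, HasDerivAt F (F' t) t := by
    intro t ht
    have hat : 0 < a * t := mul_pos ha ht.1
    have h1 : HasDerivAt (fun t => (a * t) ^ β) (a * β * (a * t) ^ (β - 1)) t := by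
      have := ((hasDerivAt_id t).const_mul a).rpow_const (p := β) (Or.inl hat.ne')
      simpa using this
    have hX : 0 < (a * t) ^ β := by positivity
    have h2 := (h1.div (h1.const_add 1) (by positivity)).const_mul (4 / β)
    have h3 : F' t = 4 / β * ((a * β * (a * t) ^ (β - 1) * (1 + (a * t) ^ β) -
        (a * t) ^ β * (a * β * (a * t) ^ (β - 1))) / (1 + (a * t) ^ β) ^ 2) := by
      simp only [hF']
      rw [Real.rpow_sub_one hat.ne']
      have := ht.1.ne'
      field_simp
      ring
    rw [h3]
    exact h2
  have hcont : ContinuousOn F (Set.Icc 0 1) := by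
    intro t ht
    have h0 : 0 ≤ a * t := mul_nonneg ha.le ht.1
    have h1 : Continuous fun t : ℝ => (a * t) ^ β :=
      (continuous_const.mul continuous_id).rpow_const fun _ => Or.inr hβ.le
    have h2 : (1 : ℝ) + (a * t) ^ β ≠ 0 := by positivity
    exact (continuousAt_const.mul (h1.continuousAt.div
      (continuousAt_const.add h1.continuousAt) h2)).continuousWithinAt
  have hnn : ∀ t ∈ Set.Ioo (0 : ℝ) 1, 0 ≤ F' t := by
    intro t ht
    have := ht.1
    simp only [hF']
    positivity
  have hint : IntegrableOn F' (Set.Ioc 0 1) :=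
    intervalIntegral.integrableOn_deriv_of_nonneg hcont hder hnn
  have hle : ∀ t ∈ Set.Ioc (0 : ℝ) 1, scaleDecay β (a * t) * t⁻¹ ≤ F' t := by
    intro t ht
    have ht0 := ht.1
    have hX : 0 < (a * t) ^ β := by positivity
    simp only [hF']
    gcongr
    refine (scaleDecay_le_min hβ.le (by positivity)).trans ?_
    rw [← mul_div_assoc, le_div_iff₀ (by positivity)]
    set X := (a * t) ^ β
    rcases le_total X 1 with h | h
    · calc min X X⁻¹ * (1 + X) ^ 2 ≤ X * (1 + 1) ^ 2 := by
            gcongr; exact min_le_left _ _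
        _ = _ := by ring
    · calc min X X⁻¹ * (1 + X) ^ 2 ≤ X⁻¹ * (X + X) ^ 2 := by
            gcongr; exact min_le_right _ _
        _ = _ := by field_simp; ring
  have hint' : IntegrableOn (fun t => scaleDecay β (a * t) * t⁻¹) (Set.Ioc 0 1) := by
    refine Integrable.mono' hint (by fun_prop) ?_
    refine (ae_restrict_iff' measurableSet_Ioc).2 (Filter.Eventually.of_forall fun t ht => ?_)
    have := ht.1
    have := scaleDecay_pos β (a * t)
    rw [Real.norm_of_nonneg (by positivity)]
    exact hle t ht
  refine ⟨hint', (setIntegral_mono_on hint' hint measurableSet_Ioc hle).trans ?_⟩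
  rw [← intervalIntegral.integral_of_le zero_le_one,
    intervalIntegral.integral_eq_sub_of_hasDerivAt_of_le zero_le_one hcont hder
      ((intervalIntegrable_iff_integrableOn_Ioc_of_le zero_le_one).2 hint)]
  have hX : 0 < (a * 1) ^ β := by positivity
  simp only [hF, mul_zero, Real.zero_rpow hβ.ne', zero_div, sub_zero]
  have : (a * 1) ^ β / (1 + (a * 1) ^ β) ≤ 1 := by
    rw [div_le_one (by positivity)]; linarith
  calc 4 / β * ((a * 1) ^ β / (1 + (a * 1) ^ β)) ≤ 4 / β * 1 := by gcongr
    _ = _ := mul_one _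

/-- The bound for `∑ k, scaleDecay β (2 ^ k * t)`. -/
noncomputable def scaleSumBound (β : ℝ) : ℝ := 4 * 2 ^ β / (2 ^ β - 1)

lemma one_le_scaleSumBound {β : ℝ} (hβ : 0 < β) : 1 ≤ scaleSumBound β := by
  have hb : (1 : ℝ) < 2 ^ β := Real.one_lt_rpow (by norm_num) hβ
  unfold scaleSumBound
  rw [le_div_iff₀ (by linarith)]
  linarith

lemma sum_prod_scaleDecay_le {d : ℕ} {β : ℝ} (hβ : 0 < β) (K : Finset (Fin d → ℕ))
    {τ : Fin d → ℝ} (hτ : ∀ i, 0 < τ i) :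
    ∑ k ∈ K, ∏ i, scaleDecay β (2 ^ k i * τ i) ≤ scaleSumBound β ^ d := by
  classical
  set n : ℕ := K.sup (fun k => Finset.univ.sup k) + 1
  have hK : K ⊆ Fintype.piFinset fun _ : Fin d => Finset.range n := by
    intro k hk
    rw [Fintype.mem_piFinset]
    intro i
    have h1 : k i ≤ Finset.univ.sup k := Finset.le_sup (Finset.mem_univ i)
    have h2 : Finset.univ.sup k ≤ K.sup (fun k => Finset.univ.sup k) :=
      Finset.le_sup (f := fun k : Fin d → ℕ => Finset.univ.sup k) hk
    rw [Finset.mem_range]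
    omega
  calc ∑ k ∈ K, ∏ i, scaleDecay β (2 ^ k i * τ i)
      ≤ ∑ k ∈ Fintype.piFinset fun _ : Fin d => Finset.range n,
          ∏ i, scaleDecay β (2 ^ k i * τ i) :=
        Finset.sum_le_sum_of_subset_of_nonneg hK fun k _ _ =>
          Finset.prod_nonneg fun i _ => (scaleDecay_pos _ _).le
    _ = ∏ i, ∑ k ∈ Finset.range n, scaleDecay β (2 ^ k * τ i) :=
        (Finset.prod_univ_sum (fun _ : Fin d => Finset.range n)
          fun i k => scaleDecay β (2 ^ k * τ i)).symm
    _ ≤ ∏ _i : Fin d, scaleSumBound β :=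
        Finset.prod_le_prod (fun i _ => Finset.sum_nonneg fun k _ => (scaleDecay_pos _ _).le)
          fun i _ => sum_scaleDecay_le hβ (hτ i) n
    _ = _ := by simp

/-- Almost-orthogonality of the scales: the sum `G` is bounded independently of `K`, so for `θ ≥ 1`
the power `G ^ θ` is at most a constant times `G`. Its integral then grows only linearly in
`K.card`. With a single term the power simply moves into the factors, for every `θ`. -/
lemma rpow_sum_prod_scaleDecay_le {d : ℕ} {β θ : ℝ} (hβ : 0 < β) (hθ : 0 < θ)
    {K : Finset (Fin d → ℕ)} (hK : 1 ≤ θ ∨ K.card = 1) {τ : Fin d → ℝ} (hτ : ∀ i, 0 < τ i) :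
    (∑ k ∈ K, ∏ i, scaleDecay β (2 ^ k i * τ i)) ^ θ ≤
      (scaleSumBound β ^ d) ^ θ *
        ∑ k ∈ K, ∏ i, scaleDecay (β * min 1 θ) (2 ^ k i * τ i) := by
  have hC : 1 ≤ scaleSumBound β ^ d := one_le_pow₀ (one_le_scaleSumBound hβ)
  have hpos : ∀ γ, ∀ k ∈ K, 0 ≤ ∏ i, scaleDecay γ (2 ^ k i * τ i) := fun γ k _ =>
    Finset.prod_nonneg fun i _ => (scaleDecay_pos _ _).le
  have hG := Finset.sum_nonneg (hpos β)
  rcases hK with h1 | h1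
  · rw [min_eq_left h1, mul_one]
    set G := ∑ k ∈ K, ∏ i, scaleDecay β (2 ^ k i * τ i) with hGdef
    have h2 : G ^ θ = G ^ (θ - 1) * G := by
      rcases hG.eq_or_lt with h0 | h0
      · rw [← h0, Real.zero_rpow hθ.ne', mul_zero]
      · rw [← Real.rpow_add_one h0.ne', sub_add_cancel]
    rw [h2]
    gcongr
    calc G ^ (θ - 1) ≤ (scaleSumBound β ^ d) ^ (θ - 1) :=
          Real.rpow_le_rpow hG (sum_prod_scaleDecay_le hβ K hτ) (by linarith)
      _ ≤ _ := Real.rpow_le_rpow_of_exponent_le hC (by linarith)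
  · obtain ⟨k, rfl⟩ := Finset.card_eq_one.1 h1
    simp only [Finset.sum_singleton]
    rw [← Real.finsetProd_rpow _ _ (fun i _ => (scaleDecay_pos _ _).le)]
    simp only [scaleDecay_rpow]
    calc ∏ i, scaleDecay (β * θ) (2 ^ k i * τ i)
        ≤ ∏ i, scaleDecay (β * min 1 θ) (2 ^ k i * τ i) :=
          Finset.prod_le_prod (fun i _ => (scaleDecay_pos _ _).le) fun i _ =>
            scaleDecay_anti (by gcongr; exact min_le_right _ _) _
      _ ≤ _ := le_mul_of_one_le_left (hpos _ k (by simp)) (Real.one_le_rpow hC hθ.le)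

/-! ### Besov norm of a superposition of scales. -/

lemma eLpNorm_unitCube_le {d : ℕ} (p : ℝ≥0∞) {g : (Fin d → ℝ) → ℂ} {C : ℝ}
    (hg : ∀ x, ‖g x‖ ≤ C) :
    eLpNorm g p (volume.restrict (unitCube d)) ≤ ENNReal.ofReal C := by
  refine (eLpNorm_le_of_ae_bound (Filter.Eventually.of_forall hg)).trans ?_
  have h : (volume : Measure (Fin d → ℝ)) (unitCube d) = 1 := by
    unfold unitCube
    rw [volume_pi_pi]
    simp
  rw [Measure.restrict_apply_univ, h, ENNReal.one_rpow, one_mul]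

/-- The weighted sum of `scaleDecay`s that controls the weighted mixed modulus. -/
noncomputable def decaySum {d : ℕ} (β : ℝ) (K : Finset (Fin d → ℕ)) (e : Finset (Fin d))
    (t : Fin d → ℝ) : ℝ :=
  ∑ k ∈ K, ∏ i, scaleDecay β (2 ^ k i * if i ∈ e then t i else 1)

/-- Weighted modulus of smoothness of a superposition of bumps on the scales `k ∈ K`. -/
lemma weighted_mixedModulus_le {d ℓ m : ℕ} {α A : ℝ} {p : ℝ≥0∞}
    (hA : 0 ≤ A) {K : Finset (Fin d → ℕ)} (hKm : ∀ k ∈ K, ∑ i, k i = m)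
    {D : Finset (Fin d) → (Fin d → ℝ) → (Fin d → ℝ) → ℂ} {e : Finset (Fin d)}
    (hD : ∀ h x, ‖D e h x‖ ≤ A * ∑ k ∈ K, ∏ i ∈ e, min 1 (2 ^ k i * |h i|) ^ ℓ)
    {t : Fin d → ℝ} (ht : ∀ i, 0 < t i) :
    (∏ i ∈ e, ENNReal.ofReal (t i) ^ (-α)) * mixedModulus D p e t ≤
      ENNReal.ofReal (A * 2 ^ (α * m) * decaySum (min α (ℓ - α)) K e t) := by
  have h1 : mixedModulus D p e t ≤
      ENNReal.ofReal (A * ∑ k ∈ K, ∏ i ∈ e, min 1 (2 ^ k i * t i) ^ ℓ) := by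
    unfold mixedModulus
    refine iSup₂_le fun h hh => (eLpNorm_unitCube_le p (hD h)).trans ?_
    gcongr with k hk i hi
    exact (hh i hi).le
  have h2 : ∏ i ∈ e, ENNReal.ofReal (t i) ^ (-α) = ENNReal.ofReal (∏ i ∈ e, t i ^ (-α)) := by
    rw [ENNReal.ofReal_prod_of_nonneg fun i _ => Real.rpow_nonneg (ht i).le _]
    exact Finset.prod_congr rfl fun i _ => ENNReal.ofReal_rpow_of_pos (ht i)
  rw [h2]
  refine (mul_le_mul_right h1 _).trans ?_
  rw [← ENNReal.ofReal_mul (Finset.prod_nonneg fun i _ => Real.rpow_nonneg (ht i).le _)]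
  apply ENNReal.ofReal_le_ofReal
  rw [mul_left_comm, mul_assoc]
  refine mul_le_mul_of_nonneg_left ?_ hA
  unfold decaySum
  rw [Finset.mul_sum, Finset.mul_sum]
  refine Finset.sum_le_sum fun k hk => ?_
  have h3 : (2 : ℝ) ^ (α * m) = ∏ i, ((2 : ℝ) ^ k i) ^ α := by
    rw [Real.finsetProd_rpow _ _ (fun i _ => by positivity), Finset.prod_pow_eq_pow_sum, hKm k hk,
      mul_comm, Real.rpow_mul (by norm_num), Real.rpow_natCast]
  have h4 : ∀ g : Fin d → ℝ, ∏ i ∈ e, g i = ∏ i, if i ∈ e then g i else 1 := fun g => by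
    rw [Finset.prod_ite_mem, Finset.univ_inter]
  rw [h3, ← Finset.prod_mul_distrib, ← Finset.prod_mul_distrib, h4]
  refine Finset.prod_le_prod (fun i _ => ?_) fun i _ => ?_
  · have := ht i
    split_ifs <;> positivity
  · have hti := ht i
    have h2k : (0 : ℝ) < 2 ^ k i := by positivity
    split_ifs with hi
    · calc t i ^ (-α) * min 1 (2 ^ k i * t i) ^ ℓ
          = ((2 : ℝ) ^ k i) ^ α * ((2 ^ k i * t i) ^ (-α) * min 1 (2 ^ k i * t i) ^ ℓ) := by
            rw [Real.mul_rpow h2k.le hti.le, Real.rpow_neg h2k.le]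
            field_simp
        _ ≤ _ := by
            gcongr
            exact rpow_mul_min_pow_le_scaleDecay (by positivity)
    -- A direction outside `e` is treated as if `t i = 1`: its share of `2 ^ (α m)` pays for the
    -- decay in `k i`. Sums over `K` thus stay bounded for every `e`.
    · have h5 := rpow_mul_min_pow_le_scaleDecay (α := α) (ℓ := ℓ) h2k
      rw [min_eq_left (one_le_pow₀ (by norm_num)), one_pow, mul_one] at h5
      rw [mul_one]
      calc (1 : ℝ) = ((2 : ℝ) ^ k i) ^ α * ((2 : ℝ) ^ k i) ^ (-α) := by
            rw [← Real.rpow_add h2k]; simp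
        _ ≤ _ := by gcongr

/-- The constant in the Besov norm estimate. -/
noncomputable def besovConst (d : ℕ) (β θinv σ : ℝ) : ℝ :=
  scaleSumBound β ^ d * (max 1 (4 / (β * σ)) ^ d) ^ θinv

/-- By Fubini each summand is a product of univariate integrals, bounded independently of the scale.
-/
lemma lintegral_prod_scaleDecay_le {d : ℕ} {β : ℝ} (hβ : 0 < β) (K : Finset (Fin d → ℕ))
    (e : Finset (Fin d)) {B : ℝ} (hB : 0 ≤ B) :
    ∫⁻ t in Set.univ.pi fun _ : Fin d => Set.Ioc (0 : ℝ) 1,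
      ENNReal.ofReal (B * decaySum β K e t) * ∏ i ∈ e, (ENNReal.ofReal (t i))⁻¹ ≤
      ENNReal.ofReal (B * (K.card * max 1 (4 / β) ^ d)) := by
  set μ : Measure (Fin d → ℝ) :=
    Measure.pi fun _ : Fin d => (volume : Measure ℝ).restrict (Set.Ioc 0 1) with hμ
  have hμ' : (volume : Measure (Fin d → ℝ)).restrict (Set.univ.pi fun _ => Set.Ioc (0 : ℝ) 1)
      = μ := by
    rw [hμ, volume_pi, Measure.restrict_pi_pi]
  set g : (Fin d → ℕ) → Fin d → ℝ → ℝ := fun k i s =>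
    if i ∈ e then scaleDecay β (2 ^ k i * s) * s⁻¹ else scaleDecay β (2 ^ k i) with hg
  have hgi : ∀ k i, Integrable (g k i) (volume.restrict (Set.Ioc 0 1)) := by
    intro k i
    by_cases hi : i ∈ e
    · simp only [hg, hi, if_true]
      exact (integrableOn_scaleDecay_div hβ (by positivity)).1
    · simp only [hg, hi, if_false]
      exact integrable_const _
  have hgb : ∀ k i, ∫ s in Set.Ioc (0 : ℝ) 1, g k i s ≤ max 1 (4 / β) := by
    intro k i
    by_cases hi : i ∈ e
    · simp only [hg, hi, if_true]
      exact (integrableOn_scaleDecay_div hβ (by positivity)).2.trans (le_max_right _ _)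
    · simp only [hg, hi, if_false]
      simpa using Or.inl (scaleDecay_le_one hβ.le _)
  have hgn : ∀ k i, ∀ s ∈ Set.Ioc (0 : ℝ) 1, 0 ≤ g k i s := by
    intro k i s hs
    have := hs.1
    have := scaleDecay_pos β (2 ^ k i * s)
    have := scaleDecay_pos β (2 ^ k i)
    simp only [hg]
    split_ifs <;> positivity
  have hmeas : MeasurableSet (Set.univ.pi fun _ : Fin d => Set.Ioc (0 : ℝ) 1) :=
    MeasurableSet.univ_pi fun _ => measurableSet_Ioc
  have hprod : ∀ k ∈ K, Integrable (fun t => ∏ i, g k i (t i)) μ := fun k _ =>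
    Integrable.fintype_prod (hgi k)
  have hInt : Integrable (fun t => B * ∑ k ∈ K, ∏ i, g k i (t i)) μ :=
    (integrable_finsetSum K hprod).const_mul B
  have hnn : ∀ t ∈ Set.univ.pi fun _ : Fin d => Set.Ioc (0 : ℝ) 1,
      0 ≤ B * ∑ k ∈ K, ∏ i, g k i (t i) := fun t ht =>
    mul_nonneg hB (Finset.sum_nonneg fun k _ => Finset.prod_nonneg fun i _ =>
      hgn k i _ (ht i (Set.mem_univ i)))
  calc _ = ∫⁻ t in Set.univ.pi fun _ : Fin d => Set.Ioc (0 : ℝ) 1,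
        ENNReal.ofReal (B * ∑ k ∈ K, ∏ i, g k i (t i)) := by
        refine setLIntegral_congr_fun hmeas fun t ht => ?_
        have ht0 : ∀ i, 0 < t i := fun i => (ht i (Set.mem_univ i)).1
        have h1 : ∏ i ∈ e, (ENNReal.ofReal (t i))⁻¹ = ENNReal.ofReal (∏ i ∈ e, (t i)⁻¹) := by
          rw [ENNReal.ofReal_prod_of_nonneg fun i _ => (inv_pos.2 (ht0 i)).le]
          exact Finset.prod_congr rfl fun i _ => (ENNReal.ofReal_inv_of_pos (ht0 i)).symm
        have h4 : ∏ i ∈ e, (t i)⁻¹ = ∏ i, if i ∈ e then (t i)⁻¹ else 1 := by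
          rw [Finset.prod_ite_mem, Finset.univ_inter]
        rw [h1, mul_comm, ← ENNReal.ofReal_mul
          (Finset.prod_nonneg fun i _ => (inv_pos.2 (ht0 i)).le), mul_left_comm]
        congr 2
        unfold decaySum
        rw [Finset.mul_sum, h4]
        refine Finset.sum_congr rfl fun k _ => ?_
        rw [← Finset.prod_mul_distrib]
        refine Finset.prod_congr rfl fun i _ => ?_
        simp only [hg]
        split_ifs
        · ring
        · simp
    _ = ENNReal.ofReal (∫ t, B * ∑ k ∈ K, ∏ i, g k i (t i) ∂μ) := by
        rw [hμ', ofReal_integral_eq_lintegral_ofReal hInt]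
        rw [← hμ']
        exact (ae_restrict_iff' hmeas).2 (Filter.Eventually.of_forall hnn)
    _ ≤ _ := by
        apply ENNReal.ofReal_le_ofReal
        rw [integral_const_mul, integral_finsetSum _ hprod]
        gcongr
        rw [← nsmul_eq_mul]
        refine Finset.sum_le_card_nsmul _ _ _ fun k _ => ?_
        rw [hμ, integral_fintype_prod_eq_prod]
        calc ∏ i, ∫ s in Set.Ioc (0 : ℝ) 1, g k i s ≤ ∏ _i : Fin d, max 1 (4 / β) :=
              Finset.prod_le_prod (fun i _ => setIntegral_nonneg measurableSet_Ioc (hgn k i))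
                fun i _ => hgb k i
          _ = _ := by simp

/-- Besov seminorm of a superposition of bumps on the scales `k ∈ K`. -/
lemma besovSeminorm_le {d ℓ m : ℕ} {α A : ℝ} {p θ : ℝ≥0∞} (hα : 0 < α) (hℓ : α < ℓ)
    (hθ : 0 < θ) (hA : 0 ≤ A) {K : Finset (Fin d → ℕ)} (hKm : ∀ k ∈ K, ∑ i, k i = m)
    (hK : 1 ≤ θ ∨ K.card = 1) {D : Finset (Fin d) → (Fin d → ℝ) → (Fin d → ℝ) → ℂ}
    {e : Finset (Fin d)}
    (hD : ∀ h x, ‖D e h x‖ ≤ A * ∑ k ∈ K, ∏ i ∈ e, min 1 (2 ^ k i * |h i|) ^ ℓ) :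
    besovSeminorm D α p θ e ≤
      ENNReal.ofReal (besovConst d (min α (ℓ - α)) (1 / θ).toReal (min 1 θ.toReal) *
        (A * 2 ^ (α * m) * (K.card : ℝ) ^ (1 / θ).toReal)) := by
  set β := min α (ℓ - α) with hβdef
  have hβ : 0 < β := lt_min hα (by linarith)
  have hC0 : 0 ≤ scaleSumBound β := zero_le_one.trans (one_le_scaleSumBound hβ)
  have hτ : ∀ t : Fin d → ℝ, (∀ i, 0 < t i) → ∀ i, 0 < if i ∈ e then t i else 1 := by
    intro t ht i
    split_ifs
    exacts [ht i, one_pos]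
  unfold besovSeminorm
  split_ifs with hθi
  · refine iSup₂_le fun t ht => ?_
    have ht0 : ∀ i, 0 < t i := fun i => (ht i (Set.mem_univ i)).1
    refine (weighted_mixedModulus_le hA hKm hD ht0).trans (ENNReal.ofReal_le_ofReal ?_)
    -- For `θ = ∞` the exponent `(1 / θ).toReal` is `0`, so the integral factor in `besovConst` and
    -- the power of `K.card` are both `1`.
    simp only [hθi, one_div, ENNReal.inv_top, ENNReal.toReal_zero, Real.rpow_zero, mul_one,
      besovConst]
    rw [mul_comm (scaleSumBound β ^ d)]
    gcongr
    exact sum_prod_scaleDecay_le hβ K (hτ t ht0)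
  · set r := θ.toReal with hr
    have hr0 : 0 < r := ENNReal.toReal_pos hθ.ne' hθi
    have hK' : 1 ≤ r ∨ K.card = 1 := hK.imp_left fun h => by
      rw [hr]
      simpa using ENNReal.toReal_mono hθi h
    have hβσ : 0 < β * min 1 r := mul_pos hβ (lt_min one_pos hr0)
    set B : ℝ := (A * 2 ^ (α * m)) ^ r * (scaleSumBound β ^ d) ^ r with hB
    have hB0 : 0 ≤ B := by positivity
    have hM : 0 ≤ max 1 (4 / (β * min 1 r)) := zero_le_one.trans (le_max_left _ _)
    calc _ ≤ (∫⁻ t in Set.univ.pi fun _ : Fin d => Set.Ioc (0 : ℝ) 1,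
            ENNReal.ofReal (B * decaySum (β * min 1 r) K e t) *
              ∏ i ∈ e, (ENNReal.ofReal (t i))⁻¹) ^ (1 / r) := by
          gcongr ?_ ^ _
          refine setLIntegral_mono' (MeasurableSet.univ_pi fun _ => measurableSet_Ioc)
            fun t ht => ?_
          have ht0 : ∀ i, 0 < t i := fun i => (ht i (Set.mem_univ i)).1
          have hdn : 0 ≤ decaySum β K e t := Finset.sum_nonneg fun k _ =>
            Finset.prod_nonneg fun i _ => (scaleDecay_pos _ _).le
          gcongr
          refine (ENNReal.rpow_le_rpow (weighted_mixedModulus_le hA hKm hD ht0) hr0.le).trans ?_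
          rw [ENNReal.ofReal_rpow_of_nonneg (by positivity) hr0.le]
          apply ENNReal.ofReal_le_ofReal
          rw [Real.mul_rpow (by positivity) hdn, hB, mul_assoc]
          gcongr
          exact rpow_sum_prod_scaleDecay_le hβ hr0 hK' (hτ t ht0)
      _ ≤ ENNReal.ofReal (B * (K.card * max 1 (4 / (β * min 1 r)) ^ d)) ^ (1 / r) := by
          gcongr
          exact lintegral_prod_scaleDecay_le hβσ K e hB0
      _ = _ := by
          rw [ENNReal.ofReal_rpow_of_nonneg (by positivity) (by positivity)]
          congr 1
          have h1 : (1 / θ).toReal = 1 / r := by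
            rw [one_div, ENNReal.toReal_inv, one_div]
          have h2 : B ^ (1 / r) = A * 2 ^ (α * m) * scaleSumBound β ^ d := by
            rw [hB, ← Real.mul_rpow (by positivity) (by positivity),
              ← Real.rpow_mul (by positivity), mul_one_div_cancel hr0.ne', Real.rpow_one]
          rw [h1, Real.mul_rpow hB0 (by positivity), h2,
            Real.mul_rpow (Nat.cast_nonneg _) (by positivity)]
          unfold besovConst
          ring

lemma besovNorm_le {d ℓ m : ℕ} {α A : ℝ} {p θ : ℝ≥0∞} (hα : 0 < α) (hℓ : α < ℓ)
    (hθ : 0 < θ) (hA : 0 ≤ A) {K : Finset (Fin d → ℕ)} (hKm : ∀ k ∈ K, ∑ i, k i = m)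
    (hK : 1 ≤ θ ∨ K.card = 1) {D : Finset (Fin d) → (Fin d → ℝ) → (Fin d → ℝ) → ℂ}
    (hD : ∀ e h x, ‖D e h x‖ ≤ A * ∑ k ∈ K, ∏ i ∈ e, min 1 (2 ^ k i * |h i|) ^ ℓ) :
    besovNorm D α p θ ≤
      ENNReal.ofReal (2 ^ d * besovConst d (min α (ℓ - α)) (1 / θ).toReal (min 1 θ.toReal) *
        (A * 2 ^ (α * m) * (K.card : ℝ) ^ (1 / θ).toReal)) := by
  unfold besovNorm
  refine (Finset.sum_le_card_nsmul _ _ _ fun e _ =>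
    besovSeminorm_le hα hℓ hθ hA hKm hK (hD e)).trans_eq ?_
  rw [nsmul_eq_mul, mul_assoc (2 ^ d : ℝ), ENNReal.ofReal_mul (p := (2 : ℝ) ^ d) (by positivity)]
  congr 1
  simp [ENNReal.ofReal_pow]

lemma besovConst_pos {d : ℕ} {β θinv σ : ℝ} (hβ : 0 < β) : 0 < besovConst d β θinv σ := by
  have h1 := zero_lt_one.trans_le (one_le_scaleSumBound hβ)
  have h2 : 0 < max 1 (4 / (β * σ)) := zero_lt_one.trans_le (le_max_left _ _)
  unfold besovConst
  positivity

/-! ### The univariate bump and its differences. -/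

/-- Peel off one difference: the `n`-th derivative of `fwdDiff η g` is an increment of that of `g`,
at most `M * |η|` by the mean value inequality. -/
lemma exists_abs_fwdDiff_iter_le (ℓ : ℕ) :
    ∀ (g : ℝ → ℝ) (M : ℝ), ContDiff ℝ ℓ g → (∀ x, |iteratedDeriv ℓ g x| ≤ M) →
      ∀ η z : ℝ, |(fwdDiff η)^[ℓ] g z| ≤ M * |η| ^ ℓ := by
  induction ℓ with
  | zero =>
    intro g M _ hM η z
    simpa using hM z
  | succ n ih =>
    intro g M hg hM η z
    rw [Function.iterate_succ_apply]
    have hg' : ContDiff ℝ n g := hg.of_le (by exact_mod_cast Nat.le_succ n)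
    have hs : ContDiff ℝ n fun x => g (x + η) := hg'.comp (contDiff_id.add contDiff_const)
    have hd : fwdDiff η g = (fun x => g (x + η)) - g := rfl
    have hdiff : Differentiable ℝ (iteratedDeriv n g) :=
      hg.differentiable_iteratedDeriv n (by exact_mod_cast Nat.lt_succ_self n)
    refine (ih (fwdDiff η g) (M * |η|) (hd ▸ hs.sub hg') (fun x => ?_) η z).trans_eq (by ring)
    rw [hd, iteratedDeriv_sub hs.contDiffAt hg'.contDiffAt, iteratedDeriv_comp_add_const]
    have := Convex.norm_image_sub_le_of_norm_deriv_le (𝕜 := ℝ) (f := iteratedDeriv n g) (C := M)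
      (s := Set.univ) (x := x) (y := x + η) (fun y _ => hdiff y)
      (fun y _ => by rw [← iteratedDeriv_succ]; exact hM y) convex_univ trivial trivial
    simpa using this

/-- A smooth bump supported in the unit interval. -/
noncomputable def unitBump (x : ℝ) : ℝ :=
  (⟨1 / 4, 1 / 2, by norm_num, by norm_num⟩ : ContDiffBump (1 / 2 : ℝ)) x

lemma contDiff_unitBump {n : ℕ} : ContDiff ℝ n unitBump := ContDiffBump.contDiff _

lemma continuous_unitBump : Continuous unitBump := ContDiffBump.continuous _

lemma hasCompactSupport_unitBump : HasCompactSupport unitBump := ContDiffBump.hasCompactSupport _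

lemma unitBump_nonneg (x : ℝ) : 0 ≤ unitBump x := ContDiffBump.nonneg _

lemma unitBump_le_one (x : ℝ) : unitBump x ≤ 1 := ContDiffBump.le_one _

lemma unitBump_eq_zero {x : ℝ} (hx : x ≤ 0 ∨ 1 ≤ x) : unitBump x = 0 := by
  refine ContDiffBump.zero_of_le_dist _ ?_
  rw [Real.dist_eq, le_abs]
  rcases hx with h | h
  · right; show (1 / 2 : ℝ) ≤ _; linarith
  · left; show (1 / 2 : ℝ) ≤ _; linarith

lemma integral_unitBump_pos : 0 < ∫ x, unitBump x := by
  refine (integral_pos_iff_support_of_nonneg unitBump_nonneg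
    (continuous_unitBump.integrable_of_hasCompactSupport hasCompactSupport_unitBump)).2 ?_
  have : Function.support unitBump = Metric.ball (1 / 2) (1 / 2) := ContDiffBump.support_eq _
  rw [this]
  exact Metric.measure_ball_pos _ _ (by norm_num)

/-- The `ℓ`-th difference of the bump with step `η`. -/
noncomputable def bumpDiff (ℓ : ℕ) (η z : ℝ) : ℝ :=
  ∑ j ∈ Finset.range (ℓ + 1), (-1 : ℝ) ^ (ℓ - j) * (ℓ.choose j : ℝ) * unitBump (z + j * η)

/-- Steps `|η| ≥ 1` use the triangle inequality and `∑ choose = 2 ^ ℓ`, small steps the `ℓ`-th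
derivative. The bound `1 ≤ M` lets `M` also dominate the undifferenced bumps. -/
lemma exists_abs_bumpDiff_le (ℓ : ℕ) :
    ∃ M : ℝ, 1 ≤ M ∧ ∀ η z : ℝ, |bumpDiff ℓ η z| ≤ M * min 1 |η| ^ ℓ := by
  obtain ⟨M, hM⟩ := (hasCompactSupport_unitBump.iteratedFDeriv (𝕜 := ℝ) ℓ).exists_bound_of_continuous
    (contDiff_unitBump.continuous_iteratedFDeriv le_rfl)
  have hM' : ∀ x, |iteratedDeriv ℓ unitBump x| ≤ M := fun x => by
    have := hM x
    rwa [norm_iteratedFDeriv_eq_norm_iteratedDeriv] at this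
  refine ⟨max M (2 ^ ℓ), le_max_of_le_right (one_le_pow₀ (by norm_num)), fun η z => ?_⟩
  rcases le_total 1 |η| with h | h
  · rw [min_eq_left h, one_pow, mul_one]
    refine le_max_of_le_right ?_
    unfold bumpDiff
    refine (Finset.abs_sum_le_sum_abs _ _).trans ?_
    calc _ ≤ ∑ j ∈ Finset.range (ℓ + 1), (ℓ.choose j : ℝ) := by
          refine Finset.sum_le_sum fun j _ => ?_
          rw [abs_mul, abs_mul, abs_pow, abs_neg, abs_one, one_pow, one_mul, Nat.abs_cast,
            abs_of_nonneg (unitBump_nonneg _)]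
          exact mul_le_of_le_one_right (Nat.cast_nonneg _) (unitBump_le_one _)
      _ = 2 ^ ℓ := by exact_mod_cast Nat.sum_range_choose ℓ
  · rw [min_eq_right h]
    have h1 : bumpDiff ℓ η z = (fwdDiff η)^[ℓ] unitBump z := by
      rw [fwdDiff_iter_eq_sum_shift]
      unfold bumpDiff
      refine Finset.sum_congr rfl fun j _ => ?_
      simp
    rw [h1]
    refine (exists_abs_fwdDiff_iter_le ℓ unitBump M contDiff_unitBump hM' η z).trans ?_
    gcongr
    exact le_max_left _ _

/-! ### Functions made of bumps on grid cells. -/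

/-- The function that equals `a s` times the tensor product bump on the unit cell with lower corner
`s ∈ ℤ^d`. -/
noncomputable def cellFun {d : ℕ} (a : (Fin d → ℤ) → ℝ) (y : Fin d → ℝ) : ℝ :=
  a (fun i => ⌊y i⌋) * ∏ i, unitBump (Int.fract (y i))

/-- Bumps of other cells vanish at `y`, so any finite box of cells containing that of `y` may be
summed. This replaces the floor function by a sum of continuous tensor products. -/
lemma cellFun_eq_sum {d : ℕ} (a : (Fin d → ℤ) → ℝ) {y : Fin d → ℝ} {T : Fin d → Finset ℤ}
    (hT : ∀ i, ⌊y i⌋ ∈ T i) :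
    cellFun a y = ∑ s ∈ Fintype.piFinset T, a s * ∏ i, unitBump (y i - s i) := by
  rw [Finset.sum_eq_single (fun i => ⌊y i⌋)]
  · rfl
  · intro s _ hs
    obtain ⟨i, hi⟩ := Function.ne_iff.1 hs
    rw [Finset.prod_eq_zero (Finset.mem_univ i), mul_zero]
    apply unitBump_eq_zero
    rcases lt_or_gt_of_ne hi with h | h
    · right
      have h1 : ((s i : ℤ) : ℝ) + 1 ≤ ⌊y i⌋ := by exact_mod_cast h
      linarith [Int.floor_le (y i)]
    · left
      have h1 : ((⌊y i⌋ : ℤ) : ℝ) + 1 ≤ s i := by exact_mod_cast h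
      linarith [Int.lt_floor_add_one (y i)]
  · intro h
    exact absurd (Fintype.mem_piFinset.2 hT) h

lemma continuous_cellFun {d : ℕ} (a : (Fin d → ℤ) → ℝ) : Continuous (cellFun a) := by
  rw [continuous_iff_continuousAt]
  intro y
  set T : Fin d → Finset ℤ := fun i => Finset.Icc (⌊y i⌋ - 1) (⌊y i⌋ + 1) with hT
  have hc : ContinuousAt
      (fun y : Fin d → ℝ => ∑ s ∈ Fintype.piFinset T, a s * ∏ i, unitBump (y i - s i)) y := by
    have := continuous_unitBump
    apply Continuous.continuousAt
    fun_prop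
  refine hc.congr ?_
  have hev : ∀ᶠ z in nhds y, ∀ i, |z i - y i| < 1 := by
    filter_upwards [Metric.ball_mem_nhds y one_pos] with z hz i
    exact (dist_le_pi_dist z y i).trans_lt hz
  filter_upwards [hev] with z hz
  refine (cellFun_eq_sum a fun i => ?_).symm
  have h1 := abs_lt.1 (hz i)
  rw [hT, Finset.mem_Icc, Int.le_floor, ← Int.lt_add_one_iff, Int.floor_lt]
  push_cast
  constructor
  · linarith [Int.floor_le (y i)]
  · linarith [Int.lt_floor_add_one (y i)]

lemma cellFun_add_of_periodic {d : ℕ} {a : (Fin d → ℤ) → ℝ} {v : Fin d → ℤ}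
    (ha : ∀ s, a (s + v) = a s) (y : Fin d → ℝ) :
    cellFun a (fun i => y i + v i) = cellFun a y := by
  unfold cellFun
  simp only [Int.floor_add_intCast, Int.fract_add_intCast]
  congr 1
  exact ha _

/-- Mixed differences of a function composed of bumps on the cells of a rectangular grid. -/
lemma exists_norm_mixedDifference_cellFun_le (d ℓ : ℕ) :
    ∃ M : ℝ, 0 < M ∧ ∀ (a : (Fin d → ℤ) → ℝ), (∀ s, |a s| ≤ 1) → ∀ (b : Fin d → ℝ),
      (∀ i, 0 ≤ b i) → ∀ (e : Finset (Fin d)) (h x : Fin d → ℝ),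
      ‖mixedDifference ℓ e h (fun x => (cellFun a (fun i => b i * x i) : ℂ)) x‖ ≤
        M * ∏ i ∈ e, min 1 (b i * |h i|) ^ ℓ := by
  obtain ⟨M, hM1, hM⟩ := exists_abs_bumpDiff_le ℓ
  have hM0 : 0 < M := by linarith
  refine ⟨((ℓ + 1 : ℕ) * M) ^ d, by positivity, fun a ha b hb e h x => ?_⟩
  -- Only cells met by the points of the difference matter: at most `ℓ + 1` indices per direction,
  -- hence a constant independent of the grid.
  set T : Fin d → Finset ℤ := fun i =>
    (Finset.range (ℓ + 1)).image fun j : ℕ => ⌊b i * (x i + j * h i)⌋ with hT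
  set J : Fin d → Finset ℕ := fun i => if i ∈ e then Finset.range (ℓ + 1) else {0} with hJ
  set c : ℕ → ℝ := fun j => (-1 : ℝ) ^ (ℓ - j) * (ℓ.choose j : ℝ) with hc
  have hJT : ∀ j ∈ Fintype.piFinset J, ∀ i, ⌊b i * (x i + j i * h i)⌋ ∈ T i := by
    intro j hj i
    refine Finset.mem_image_of_mem (fun j : ℕ => ⌊b i * (x i + j * h i)⌋) ?_
    have := Fintype.mem_piFinset.1 hj i
    simp only [hJ] at this
    split_ifs at this with hi
    · exact this
    · rw [Finset.mem_singleton] at this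
      simp [this]
  have hkey : mixedDifference ℓ e h (fun x => (cellFun a (fun i => b i * x i) : ℂ)) x =
      ((∑ s ∈ Fintype.piFinset T, a s *
        ∏ i, if i ∈ e then bumpDiff ℓ (b i * h i) (b i * x i - s i)
          else unitBump (b i * x i - s i) : ℝ) : ℂ) := by
    have h1 : mixedDifference ℓ e h (fun x => (cellFun a (fun i => b i * x i) : ℂ)) x =
        ((∑ j ∈ Fintype.piFinset J, (∏ i ∈ e, c (j i)) *
          cellFun a (fun i => b i * (x i + j i * h i)) : ℝ) : ℂ) := by
      unfold mixedDifference
      simp only [hc]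
      push_cast
      rfl
    rw [h1]
    congr 1
    have h2 : ∀ j ∈ Fintype.piFinset J, (∏ i ∈ e, c (j i)) *
        cellFun a (fun i => b i * (x i + j i * h i)) = ∑ s ∈ Fintype.piFinset T, a s *
          ∏ i, ((if i ∈ e then c (j i) else 1) * unitBump (b i * (x i + j i * h i) - s i)) := by
      intro j hj
      rw [cellFun_eq_sum a (hJT j hj), Finset.mul_sum]
      refine Finset.sum_congr rfl fun s _ => ?_
      have h6 : ∏ i, ((if i ∈ e then c (j i) else 1) *
          unitBump (b i * (x i + j i * h i) - s i)) =
          (∏ i, if i ∈ e then c (j i) else 1) * ∏ i, unitBump (b i * (x i + j i * h i) - s i) :=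
        Finset.prod_mul_distrib
      rw [h6, Finset.prod_ite_mem, Finset.univ_inter]
      ring
    -- For a fixed cell the sum over `j` factorises into univariate differences of the bump.
    rw [Finset.sum_congr rfl h2, Finset.sum_comm]
    refine Finset.sum_congr rfl fun s _ => ?_
    rw [← Finset.mul_sum]
    congr 1
    rw [← Finset.prod_univ_sum J fun i j =>
      (if i ∈ e then c j else 1) * unitBump (b i * (x i + j * h i) - s i)]
    refine Finset.prod_congr rfl fun i _ => ?_
    simp only [hJ]
    split_ifs with hi
    · unfold bumpDiff
      refine Finset.sum_congr rfl fun j _ => ?_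
      rw [show b i * x i - s i + j * (b i * h i) = b i * (x i + j * h i) - s i by ring]
    · simp
  rw [hkey, Complex.norm_real, Real.norm_eq_abs]
  refine (Finset.abs_sum_le_sum_abs _ _).trans ?_
  have hterm : ∀ s ∈ Fintype.piFinset T, |a s *
      ∏ i, if i ∈ e then bumpDiff ℓ (b i * h i) (b i * x i - s i)
        else unitBump (b i * x i - s i)| ≤ M ^ d * ∏ i ∈ e, min 1 (b i * |h i|) ^ ℓ := by
    intro s _
    rw [abs_mul, Finset.abs_prod]
    refine (mul_le_of_le_one_left (Finset.prod_nonneg fun i _ => abs_nonneg _) (ha s)).trans ?_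
    have h4 : ∏ i ∈ e, min 1 (b i * |h i|) ^ ℓ =
        ∏ i, if i ∈ e then min 1 (b i * |h i|) ^ ℓ else 1 := by
      rw [Finset.prod_ite_mem, Finset.univ_inter]
    have h5 : M ^ d = ∏ _i : Fin d, M := by simp
    rw [h4, h5, ← Finset.prod_mul_distrib]
    refine Finset.prod_le_prod (fun i _ => abs_nonneg _) fun i _ => ?_
    split_ifs with hi
    · have := hM (b i * h i) (b i * x i - s i)
      rwa [abs_mul, abs_of_nonneg (hb i)] at this
    · rw [abs_of_nonneg (unitBump_nonneg _), mul_one]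
      exact (unitBump_le_one _).trans hM1
  refine (Finset.sum_le_card_nsmul _ _ _ hterm).trans ?_
  rw [nsmul_eq_mul, mul_pow, mul_assoc]
  have hnn : 0 ≤ M ^ d * ∏ i ∈ e, min 1 (b i * |h i|) ^ ℓ :=
    mul_nonneg (by positivity) (Finset.prod_nonneg fun i _ =>
      pow_nonneg (le_min zero_le_one (mul_nonneg (hb i) (abs_nonneg _))) _)
  refine mul_le_mul_of_nonneg_right ?_ hnn
  have hcard : (Fintype.piFinset T).card ≤ (ℓ + 1) ^ d := by
    rw [Fintype.card_piFinset]
    calc ∏ i, (T i).card ≤ ∏ _i : Fin d, (ℓ + 1) := by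
          refine Finset.prod_le_prod' fun i _ => ?_
          simpa using Finset.card_image_le (s := Finset.range (ℓ + 1))
            (f := fun j : ℕ => ⌊b i * (x i + j * h i)⌋)
      _ = _ := by simp
  exact_mod_cast hcard

lemma integral_unitBump_comp {b : ℝ} (hb : 0 < b) (s : ℝ) :
    ∫ x, unitBump (b * x - s) = b⁻¹ * ∫ x, unitBump x := by
  rw [Measure.integral_comp_mul_left (fun x => unitBump (x - s)) b, integral_sub_right_eq_self,
    abs_of_pos (inv_pos.2 hb), smul_eq_mul]

/-- Integral over the unit cube of a function composed of bumps on a dyadic grid. -/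
lemma integral_cellFun {d : ℕ} (a : (Fin d → ℤ) → ℝ) (b : Fin d → ℕ) (hb : ∀ i, 0 < b i) :
    ∫ x in unitCube d, cellFun a (fun i => b i * x i) =
      (∑ s ∈ Fintype.piFinset fun i => Finset.Ico (0 : ℤ) (b i), a s) *
        ((∏ i, (b i : ℝ))⁻¹ * (∫ x, unitBump x) ^ d) := by
  have hcube : unitCube d =ᵐ[volume] Set.univ.pi fun _ => Set.Ico (0 : ℝ) 1 := by
    unfold unitCube
    rw [Set.pi_univ_Icc]
    exact (Measure.univ_pi_Ico_ae_eq_Icc (μ := fun _ : Fin d => (volume : Measure ℝ))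
      (f := fun _ => 0) (g := fun _ => 1)).symm
  have hbR : ∀ i, (0 : ℝ) < b i := fun i => by exact_mod_cast hb i
  rw [setIntegral_congr_set hcube]
  have hmeas : MeasurableSet (Set.univ.pi fun _ : Fin d => Set.Ico (0 : ℝ) 1) :=
    MeasurableSet.univ_pi fun _ => measurableSet_Ico
  have h1 : ∀ x ∈ Set.univ.pi fun _ : Fin d => Set.Ico (0 : ℝ) 1,
      cellFun a (fun i => b i * x i) =
        ∑ s ∈ Fintype.piFinset fun i => Finset.Ico (0 : ℤ) (b i),
          a s * ∏ i, unitBump (b i * x i - s i) := by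
    intro x hx
    refine cellFun_eq_sum a fun i => ?_
    have := hx i (Set.mem_univ i)
    have hbi := hbR i
    rw [Finset.mem_Ico, Int.le_floor, Int.floor_lt]
    refine ⟨?_, ?_⟩
    · have := mul_nonneg hbi.le this.1
      simpa using this
    · have := mul_lt_mul_of_pos_left this.2 hbi
      simpa using this
  rw [setIntegral_congr_fun hmeas h1]
  -- The bumps of cells inside the cube vanish outside it, so the integral extends to the whole
  -- space, where it factorises.
  rw [setIntegral_eq_integral_of_forall_compl_eq_zero]
  · rw [integral_finsetSum]
    · rw [Finset.sum_mul]
      refine Finset.sum_congr rfl fun s _ => ?_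
      rw [integral_const_mul, integral_fintype_prod_volume_eq_prod
        (fun (i : Fin d) (t : ℝ) => unitBump (b i * t - s i))]
      simp only [integral_unitBump_comp (hbR _), Finset.prod_mul_distrib, Finset.prod_const,
        Finset.card_univ, Fintype.card_fin, Finset.prod_inv_distrib]
    · intro s _
      refine Integrable.const_mul ?_ _
      refine Integrable.fintype_prod (f := fun (i : Fin d) (t : ℝ) => unitBump (b i * t - s i))
        fun i => ?_
      have h2 : Integrable fun t => unitBump (t - s i) :=
        (continuous_unitBump.integrable_of_hasCompactSupport
          hasCompactSupport_unitBump).comp_sub_right _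
      exact h2.comp_mul_left' (hbR i).ne'
  · intro x hx
    refine Finset.sum_eq_zero fun s hs => ?_
    simp only [Set.mem_pi, not_forall, Set.mem_univ, Set.mem_Ico, not_and_or, not_le, not_lt,
      exists_prop, true_and] at hx
    obtain ⟨i, hi⟩ := hx
    have hsi := Finset.mem_Ico.1 (Fintype.mem_piFinset.1 hs i)
    have hbi := hbR i
    rw [Finset.prod_eq_zero (Finset.mem_univ i), mul_zero]
    apply unitBump_eq_zero
    have h3 : (0 : ℝ) ≤ s i := by exact_mod_cast hsi.1
    have h4 : (s i : ℝ) + 1 ≤ b i := by exact_mod_cast hsi.2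
    rcases hi with h | h
    · left; nlinarith
    · right; nlinarith

/-! ### Cells without knots, and sets of scales. -/

open Classical in
/-- The indicator of the cells of the periodic grid with `b i` cells in direction `i` that contain
none of the points `X j`. -/
noncomputable def emptyCell {d n : ℕ} (X : Fin n → Fin d → ℝ) (b : Fin d → ℕ)
    (s : Fin d → ℤ) : ℝ :=
  if ∃ j, ∀ i, (b i : ℤ) ∣ ⌊b i * X j i⌋ - s i then 0 else 1

lemma abs_emptyCell_le_one {d n : ℕ} (X : Fin n → Fin d → ℝ) (b : Fin d → ℕ) (s : Fin d → ℤ) :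
    |emptyCell X b s| ≤ 1 := by
  unfold emptyCell
  split_ifs <;> simp

lemma emptyCell_add {d n : ℕ} (X : Fin n → Fin d → ℝ) {b : Fin d → ℕ} {v : Fin d → ℤ}
    (hv : ∀ i, (b i : ℤ) ∣ v i) (s : Fin d → ℤ) : emptyCell X b (s + v) = emptyCell X b s := by
  unfold emptyCell
  simp only [Pi.add_apply, ← sub_sub]
  have : ∀ j i, ((b i : ℤ) ∣ ⌊b i * X j i⌋ - s i - v i) ↔ ((b i : ℤ) ∣ ⌊b i * X j i⌋ - s i) :=
    fun j i => dvd_sub_left (hv i)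
  simp only [this]

lemma cellFun_emptyCell_apply {d n : ℕ} (X : Fin n → Fin d → ℝ) (b : Fin d → ℕ) (j : Fin n) :
    cellFun (emptyCell X b) (fun i => b i * X j i) = 0 := by
  unfold cellFun emptyCell
  rw [if_pos ⟨j, fun i => by simp⟩, zero_mul]

/-- Each knot excludes at most one cell of the box: the one given by the residues of `⌊b i * X j i⌋`
modulo `b i`. -/
lemma sub_le_sum_emptyCell {d n : ℕ} (X : Fin n → Fin d → ℝ) (b : Fin d → ℕ) :
    ∏ i, (b i : ℝ) - n ≤
      ∑ s ∈ Fintype.piFinset fun i => Finset.Ico (0 : ℤ) (b i), emptyCell X b s := by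
  classical
  set S := Fintype.piFinset fun i => Finset.Ico (0 : ℤ) (b i) with hS
  set Z := S.filter fun s => ∃ j, ∀ i, (b i : ℤ) ∣ ⌊b i * X j i⌋ - s i with hZ
  have hcard : (S.card : ℝ) = ∏ i, (b i : ℝ) := by
    rw [hS, Fintype.card_piFinset]
    simp
  have hZn : Z.card ≤ n := by
    have hsub : Z ⊆ Finset.univ.image fun (j : Fin n) (i : Fin d) => ⌊b i * X j i⌋ % (b i : ℤ) := by
      intro s hs
      obtain ⟨hsS, j, hj⟩ := Finset.mem_filter.1 hs
      refine Finset.mem_image.2 ⟨j, Finset.mem_univ j, funext fun i => ?_⟩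
      have hsi := Finset.mem_Ico.1 (Fintype.mem_piFinset.1 hsS i)
      rw [Int.emod_eq_emod_iff_emod_sub_eq_zero.2 (Int.emod_eq_zero_of_dvd (hj i)),
        Int.emod_eq_of_lt hsi.1 hsi.2]
    calc Z.card ≤ _ := Finset.card_le_card hsub
      _ ≤ _ := Finset.card_image_le
      _ = n := by simp
  have hsum : ∑ s ∈ S, emptyCell X b s = S.card - Z.card := by
    have h1 : ∀ s ∈ S, emptyCell X b s =
        1 - if ∃ j, ∀ i, (b i : ℤ) ∣ ⌊b i * X j i⌋ - s i then (1 : ℝ) else 0 := by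
      intro s _
      unfold emptyCell
      split_ifs <;> simp
    rw [Finset.sum_congr rfl h1, Finset.sum_sub_distrib, Finset.sum_boole]
    simp [hZ]
  rw [hsum, hcard]
  have : (Z.card : ℝ) ≤ n := by exact_mod_cast hZn
  linarith

/-- A family of `(q + 1) ^ D` multi-indices of length `D + 1` and of order `m`. -/
lemma exists_finset_sum_eq {D q m : ℕ} (h : D * q ≤ m) :
    ∃ K : Finset (Fin (D + 1) → ℕ), (∀ k ∈ K, ∑ i, k i = m) ∧ K.card = (q + 1) ^ D := by
  classical
  -- The last `D` entries range freely over `{0, …, q}` and the first one fills up to `m`; `D * q ≤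
  -- m` makes the truncated subtraction exact.
  refine ⟨(Fintype.piFinset fun _ : Fin D => Finset.range (q + 1)).image
    fun v => Fin.cons (m - ∑ i, v i) v, fun k hk => ?_, ?_⟩
  · obtain ⟨v, hv, rfl⟩ := Finset.mem_image.1 hk
    have h1 : ∑ i, v i ≤ D * q := by
      have := Finset.sum_le_card_nsmul Finset.univ v q fun i _ =>
        Nat.lt_succ_iff.1 (Finset.mem_range.1 (Fintype.mem_piFinset.1 hv i))
      simpa using this
    rw [Fin.sum_univ_succ]
    simp only [Fin.cons_zero, Fin.cons_succ]
    omega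
  · rw [Finset.card_image_of_injective _ fun v w hvw => (Fin.cons_injective2 hvw).2,
      Fintype.card_piFinset]
    simp

/-! ### Fooling functions. -/

lemma mixedDifference_const_mul_sum {d ℓ : ℕ} {ι : Type*} (e : Finset (Fin d)) (h : Fin d → ℝ)
    (c : ℂ) (K : Finset ι) (g : ι → (Fin d → ℝ) → ℂ) (x : Fin d → ℝ) :
    mixedDifference ℓ e h (fun x => c * ∑ k ∈ K, g k x) x =
      c * ∑ k ∈ K, mixedDifference ℓ e h (g k) x := by
  unfold mixedDifference
  rw [Finset.sum_comm, Finset.mul_sum]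
  refine Finset.sum_congr rfl fun j _ => ?_
  rw [← Finset.mul_sum]
  ring

lemma isCompact_unitCube (d : ℕ) : IsCompact (unitCube d) :=
  isCompact_univ_pi fun _ => isCompact_Icc

/-- Fooling functions for cubature formulas: members of the unit ball that vanish at all knots
and have a large integral. -/
lemma exists_fooling_function (d ℓ : ℕ) {α : ℝ} (p : ℝ≥0∞) {θ : ℝ≥0∞} (hα : 0 < α) (hℓ : α < ℓ)
    (hθ : 0 < θ) :
    ∃ c : ℝ, 0 < c ∧ ∀ (n m : ℕ) (X : Fin n → Fin d → ℝ) (K : Finset (Fin d → ℕ)),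
      2 * n ≤ 2 ^ m → (∀ k ∈ K, ∑ i, k i = m) → K.Nonempty → (1 ≤ θ ∨ K.card = 1) →
      ∃ f ∈ torusBall d ℓ α p θ, (∀ j, f (X j) = 0) ∧
        c * (2 ^ (α * m))⁻¹ * (K.card : ℝ) ^ (1 - (1 / θ).toReal) ≤ ‖∫ x in unitCube d, f x‖ := by
  obtain ⟨M, hM0, hM⟩ := exists_norm_mixedDifference_cellFun_le d ℓ
  set β := min α (ℓ - α)
  have hβ : 0 < β := lt_min hα (by linarith)
  set B := 2 ^ d * besovConst d β (1 / θ).toReal (min 1 θ.toReal) with hB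
  have hB0 : 0 < B := mul_pos (by positivity) (besovConst_pos hβ)
  set I := ∫ x, unitBump x with hI
  have hI0 : 0 < I := integral_unitBump_pos
  refine ⟨(B * M)⁻¹ * (I ^ d / 2), by positivity, fun n m X K hnm hKm hKne hK => ?_⟩
  set N : ℝ := (K.card : ℝ) with hN
  have hN0 : 0 < N := by
    rw [hN]
    exact_mod_cast hKne.card_pos
  -- Normalisation that turns the bound of `besovNorm_le` into exactly `1`.
  set A : ℝ := (B * M * 2 ^ (α * m) * N ^ (1 / θ).toReal)⁻¹ with hA
  have hA0 : 0 < A := by positivity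
  set b : (Fin d → ℕ) → Fin d → ℕ := fun k i => 2 ^ k i with hb
  set g : (Fin d → ℕ) → (Fin d → ℝ) → ℝ := fun k x =>
    cellFun (emptyCell X (b k)) (fun i => b k i * x i) with hg
  have hgc : ∀ k, Continuous (g k) := fun k =>
    (continuous_cellFun _).comp (continuous_pi fun i => continuous_const.mul (continuous_apply i))
  set f : (Fin d → ℝ) → ℂ := fun x => (A : ℂ) * ∑ k ∈ K, (g k x : ℂ) with hf
  have hfr : ∀ x, f x = ((A * ∑ k ∈ K, g k x : ℝ) : ℂ) := fun x => by
    simp only [hf]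
    push_cast
    rfl
  refine ⟨f, ⟨⟨?_, ?_⟩, ?_⟩, ?_, ?_⟩
  · exact continuous_const.mul (continuous_finsetSum _ fun k _ =>
      Complex.continuous_ofReal.comp (hgc k))
  · intro i x
    simp only [hf]
    congr 1
    refine Finset.sum_congr rfl fun k _ => ?_
    congr 1
    -- Adding `1` to `x i` shifts the grid by `b k i` cells, a period of `emptyCell`.
    have h1 := cellFun_add_of_periodic (a := emptyCell X (b k)) (v := Pi.single i (b k i : ℤ))
      (fun s => emptyCell_add X (fun i' => by
        rcases eq_or_ne i' i with rfl | hne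
        · simp
        · simp [Pi.single_eq_of_ne hne]) s) (fun i => b k i * x i)
    simp only [hg]
    rw [← h1]
    congr 1
    funext i'
    rcases eq_or_ne i' i with rfl | hne
    · simp [mul_add]
    · simp [Pi.single_eq_of_ne hne]
  · unfold torusBesovNorm
    have hD : ∀ e h x, ‖mixedDifference ℓ e h f x‖ ≤
        (A * M) * ∑ k ∈ K, ∏ i ∈ e, min 1 (2 ^ k i * |h i|) ^ ℓ := by
      intro e h x
      rw [hf, mixedDifference_const_mul_sum, norm_mul, Complex.norm_real,
        Real.norm_of_nonneg hA0.le, mul_assoc, Finset.mul_sum]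
      gcongr
      refine (norm_sum_le _ _).trans (Finset.sum_le_sum fun k _ => ?_)
      have := hM (emptyCell X (b k)) (abs_emptyCell_le_one X _) (fun i => b k i)
        (fun i => Nat.cast_nonneg _) e h x
      simpa [hb, hg] using this
    refine (besovNorm_le hα hℓ hθ (by positivity) hKm hK hD).trans ?_
    rw [ENNReal.ofReal_le_one]
    apply le_of_eq
    rw [← hB, ← hN, hA]
    field_simp
  · intro j
    simp only [hf, hg]
    simp [cellFun_emptyCell_apply]
  · have hint : ∀ k ∈ K, IntegrableOn (g k) (unitCube d) := fun k _ =>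
      (hgc k).continuousOn.integrableOn_compact (isCompact_unitCube d)
    have h1 : ∫ x in unitCube d, f x = ((A * ∑ k ∈ K, ∫ x in unitCube d, g k x : ℝ) : ℂ) := by
      simp only [hfr]
      rw [integral_complex_ofReal, integral_const_mul, integral_finsetSum _ hint]
    have h2 : ∀ k ∈ K, I ^ d / 2 ≤ ∫ x in unitCube d, g k x := by
      intro k hk
      have hprod : ∏ i, (b k i : ℝ) = 2 ^ m := by
        simp only [hb, Nat.cast_pow, Nat.cast_ofNat]
        rw [Finset.prod_pow_eq_pow_sum, hKm k hk]
      have h3 := sub_le_sum_emptyCell X (b k)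
      simp only [hg]
      rw [integral_cellFun _ _ fun i => by positivity, hprod, ← hI]
      rw [hprod] at h3
      have h4 : (2 : ℝ) * n ≤ 2 ^ m := by exact_mod_cast hnm
      calc I ^ d / 2 = (2 ^ m / 2) * ((2 ^ m)⁻¹ * I ^ d) := by field_simp
        _ ≤ _ := by
          gcongr
          linarith
    have h5 : N * (I ^ d / 2) ≤ ∑ k ∈ K, ∫ x in unitCube d, g k x := by
      have := Finset.card_nsmul_le_sum K _ _ h2
      rwa [nsmul_eq_mul] at this
    rw [h1, Complex.norm_real]
    refine le_trans ?_ (le_abs_self _)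
    refine le_trans (le_of_eq ?_) (mul_le_mul_of_nonneg_left h5 hA0.le)
    rw [hA, Real.rpow_sub hN0, Real.rpow_one]
    field_simp

/-! ### Comparison of the classes and conclusion. -/

lemma eLpNorm_cubeDifference_le {d ℓ : ℕ} (e : Finset (Fin d)) (h : Fin d → ℝ)
    (f : (Fin d → ℝ) → ℂ) (p : ℝ≥0∞) (μ : Measure (Fin d → ℝ)) :
    eLpNorm (cubeDifference ℓ e h f) p μ ≤ eLpNorm (mixedDifference ℓ e h f) p μ := by
  refine eLpNorm_mono fun x => ?_
  unfold cubeDifference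
  split_ifs <;> simp

/-- Truncation only decreases differences pointwise. Hence the torus ball lies in the other two
classes, and fooling functions for it serve all three. -/
lemma cubeBesovNorm_le_torusBesovNorm {d ℓ : ℕ} (α : ℝ) (p θ : ℝ≥0∞) (f : (Fin d → ℝ) → ℂ) :
    cubeBesovNorm ℓ α p θ f ≤ torusBesovNorm ℓ α p θ f := by
  have hmod : ∀ e t, mixedModulus (fun e h => cubeDifference ℓ e h f) p e t ≤
      mixedModulus (fun e h => mixedDifference ℓ e h f) p e t := fun e t =>
    iSup₂_mono fun h _ => eLpNorm_cubeDifference_le e h f p _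
  unfold cubeBesovNorm torusBesovNorm besovNorm
  refine Finset.sum_le_sum fun e _ => ?_
  unfold besovSeminorm
  split_ifs
  · exact iSup₂_mono fun t _ => mul_le_mul_right (hmod e t) _
  · gcongr
    exact hmod _ _

lemma torusBall_subset_cubeBall (d ℓ : ℕ) (α : ℝ) (p θ : ℝ≥0∞) :
    torusBall d ℓ α p θ ⊆ cubeBall d ℓ α p θ := fun f hf =>
  ⟨hf.1.1.continuousOn, (cubeBesovNorm_le_torusBesovNorm α p θ f).trans hf.2⟩

lemma optimalCubatureError_mono {d n : ℕ} {F G : Set ((Fin d → ℝ) → ℂ)} (h : F ⊆ G) :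
    optimalCubatureError n F ≤ optimalCubatureError n G :=
  iInf_mono fun _ => iInf_mono fun _ => iInf_mono fun _ => biSup_mono fun _ hf => h hf

lemma le_optimalCubatureError {d n : ℕ} {F : Set ((Fin d → ℝ) → ℂ)} {c : ℝ}
    (h : ∀ X : Fin n → Fin d → ℝ, ∃ f ∈ F, (∀ j, f (X j) = 0) ∧ c ≤ ‖∫ x in unitCube d, f x‖) :
    ENNReal.ofReal c ≤ optimalCubatureError n F := by
  refine le_iInf fun X => le_iInf fun _ => le_iInf fun w => ?_
  obtain ⟨f, hf, hX, hc⟩ := h X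
  refine le_iSup₂_of_le f hf (ENNReal.ofReal_le_ofReal ?_)
  have : cubature X w f = 0 := Finset.sum_eq_zero fun j _ => by rw [hX j, mul_zero]
  rwa [this, sub_zero]

lemma log_natCast_le_log_two_add_two (n : ℕ) : Real.log n ≤ (Nat.log 2 n + 2 : ℕ) := by
  rcases Nat.eq_zero_or_pos n with rfl | hn
  · simp
  have h1 : (n : ℝ) ≤ 2 ^ (Nat.log 2 n + 1) := by
    exact_mod_cast (Nat.lt_pow_succ_log_self (by norm_num) n).le
  have h2 := Real.log_le_log (by exact_mod_cast hn) h1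
  rw [Real.log_pow] at h2
  have h3 : Real.log 2 ≤ 1 := Real.log_two_lt_d9.le.trans (by norm_num)
  push_cast at h2 ⊢
  have h4 : (0 : ℝ) ≤ (Nat.log 2 n : ℝ) + 1 := by positivity
  nlinarith

theorem theorem4p1 (d : ℕ) (hd : 1 ≤ d) (p θ : ℝ≥0∞) (hp : 0 < p) (hθ : 0 < θ)
    (α : ℝ) (hα : 1 / p < ENNReal.ofReal α) (ℓ : ℕ) (hℓ : α < ℓ) :
    ∃ c : ℝ, 0 < c ∧ ∀ n : ℕ, 1 ≤ n → ∀ F : Set ((Fin d → ℝ) → ℂ),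
      (F = torusBall d ℓ α p θ ∨
        F = {f ∈ cubeBall d ℓ α p θ | IsTorusFunction f} ∨
        F = cubeBall d ℓ α p θ) →
      ENNReal.ofReal (c * (n : ℝ) ^ (-α) *
          Real.log n ^ (((d : ℝ) - 1) * max (1 - (1 / θ).toReal) 0)) ≤
        optimalCubatureError n F := by
  obtain ⟨D, rfl⟩ : ∃ D, d = D + 1 := ⟨d - 1, by omega⟩
  have hα0 : 0 < α := ENNReal.ofReal_pos.1 (bot_le.trans_lt hα)
  obtain ⟨c, hc, hfool⟩ := exists_fooling_function (D + 1) ℓ p hα0 hℓ hθ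
  set E := max (1 - (1 / θ).toReal) 0 with hE
  have hE0 : 0 ≤ E := le_max_right _ _
  have hdD : ((D + 1 : ℕ) : ℝ) - 1 = D := by push_cast; ring
  rw [hdD]
  -- Pays for `log n ≤ (D + 1) * (q + 1)` with `q = m / (D + 1)`, raised to the power `D * E`.
  set R : ℝ := ((D : ℝ) + 1) ^ (D * E) with hR
  have hR0 : 0 < R := by positivity
  refine ⟨c * 4 ^ (-α) * R⁻¹, by positivity, fun n hn F hF => ?_⟩
  have hsub : torusBall (D + 1) ℓ α p θ ⊆ F := by
    have h := torusBall_subset_cubeBall (D + 1) ℓ α p θ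
    rcases hF with rfl | rfl | rfl
    · exact subset_rfl
    · exact fun f hf => ⟨h hf, hf.1⟩
    · exact h
  refine le_trans (le_optimalCubatureError fun X => ?_) (optimalCubatureError_mono hsub)
  -- The shift by `2` gives `2 * n ≤ 2 ^ m ≤ 4 * n`: the first bound leaves half of the cells empty,
  -- the second costs the factor `4 ^ (-α)`.
  set m := Nat.log 2 n + 2 with hm
  have hnm : 2 * n ≤ 2 ^ m := by
    have := Nat.lt_pow_succ_log_self (b := 2) (by norm_num) n
    rw [hm, pow_succ]
    omega
  have hmn : 2 ^ m ≤ 4 * n := by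
    have := Nat.pow_log_le_self 2 (x := n) (by omega)
    rw [hm, pow_add]
    omega
  have hn0 : (0 : ℝ) < n := by exact_mod_cast hn
  have hpow : (4 : ℝ) ^ (-α) * (n : ℝ) ^ (-α) ≤ (2 ^ (α * m))⁻¹ := by
    have h1 : (2 : ℝ) ^ (α * m) = ((2 : ℝ) ^ m) ^ α := by
      rw [mul_comm, Real.rpow_mul (by norm_num), Real.rpow_natCast]
    rw [← Real.mul_rpow (by norm_num) hn0.le, Real.rpow_neg (by positivity), h1]
    gcongr
    exact_mod_cast hmn
  have hlog0 : 0 ≤ Real.log n := Real.log_natCast_nonneg n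
  obtain ⟨K, hKm, hKne, hK, hKc⟩ : ∃ K : Finset (Fin (D + 1) → ℕ), (∀ k ∈ K, ∑ i, k i = m) ∧
      K.Nonempty ∧ (1 ≤ θ ∨ K.card = 1) ∧
      Real.log n ^ (D * E) ≤ R * (K.card : ℝ) ^ (1 - (1 / θ).toReal) := by
    rcases le_or_gt 1 θ with h1 | h1
    · obtain ⟨K, hKm, hKc⟩ := exists_finset_sum_eq (D := D) (q := m / (D + 1)) (m := m)
        ((Nat.mul_le_mul_right _ (Nat.le_succ D)).trans (Nat.mul_div_le m (D + 1)))
      refine ⟨K, hKm, Finset.card_pos.1 (by rw [hKc]; positivity), Or.inl h1, ?_⟩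
      have h2 : (1 / θ).toReal ≤ 1 := by
        rw [one_div]
        exact ENNReal.toReal_le_of_le_ofReal zero_le_one (by simpa using h1)
      have h3 : E = 1 - (1 / θ).toReal := max_eq_left (by linarith)
      have h4 : Real.log n ≤ ((D : ℝ) + 1) * ((m / (D + 1) : ℕ) + 1) := by
        refine (log_natCast_le_log_two_add_two n).trans ?_
        have := Nat.lt_mul_div_succ m (Nat.succ_pos D)
        exact_mod_cast this.le
      rw [← h3, hKc, hR]
      push_cast
      rw [← Real.rpow_natCast, ← Real.rpow_mul (by positivity), ← Real.mul_rpow (by positivity)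
        (by positivity)]
      gcongr
    -- For `θ < 1` the exponent `1 - 1/θ` is negative, so more scales would only hurt and one is
    -- used. The logarithm has exponent `0`, and its power is `1` even at `n = 1`.
    · obtain ⟨K, hKm, hKc⟩ := exists_finset_sum_eq (D := D) (q := 0) (m := m) (by simp)
      rw [zero_add, one_pow] at hKc
      refine ⟨K, hKm, Finset.card_pos.1 (by rw [hKc]; exact one_pos), Or.inr hKc, ?_⟩
      have h2 : 1 ≤ (1 / θ).toReal := by
        have h3 : 1 ≤ 1 / θ := by
          rw [one_div]
          exact ENNReal.one_le_inv.2 h1.le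
        have h4 : 1 / θ ≠ ∞ := by
          rw [one_div]
          exact ENNReal.inv_ne_top.2 hθ.ne'
        simpa using ENNReal.toReal_mono h4 h3
      have h3 : E = 0 := max_eq_right (by linarith)
      rw [hKc, hR, h3]
      simp
  obtain ⟨f, hf, hfX, hfint⟩ := hfool n m X K hnm hKm hKne hK
  refine ⟨f, hf, hfX, le_trans ?_ hfint⟩
  calc c * 4 ^ (-α) * R⁻¹ * (n : ℝ) ^ (-α) * Real.log n ^ (D * E)
      = c * (4 ^ (-α) * (n : ℝ) ^ (-α)) * (R⁻¹ * Real.log n ^ (D * E)) := by ring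
    _ ≤ c * (2 ^ (α * m))⁻¹ * (K.card : ℝ) ^ (1 - (1 / θ).toReal) := by
        gcongr
        rwa [inv_mul_le_iff₀ hR0]
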